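/- Let $n\ge 1$ and let $x_1,\dots,x_n$ be indeterminates. Identify a partition with its Ferrers diagram (row $i$ has $\mu_i$ left-justified boxes, rows numbered from the top starting at $1$), and let $\delta_m=(m,m-1,\dots,1)$ (so $\delta_0=\varnothing$). For a partition $\mu$ let $$s_\mu(X_n)=\sum_T\prod_{i=1}^n x_i^{m_i(T)},$$ where $T$ runs over the semistandard tableaux of shape $\mu$ with entries in $\{1,\dots,n\}$ (rows weakly increasing from left to right, columns strictly increasing from top to bottom) and $m_i(T)$ is the number of entries of $T$ equal to $i$. For $\mu\subseteq\delta_{n-1}$ let $r^{(n)}_\mu$ be the number of fillings of the boxes of $\mu$ with positive integers that are strictly decreasing along rows from left to right, weakly decreasing down columns, and have all entries of row $i$ in $[1,n-i]$ (reverse flagged fillings; $r^{(n)}_\varnothing=1$). For $\mu\subseteq\lambda$ the set of boxes $\lambda/\mu$ is called a vertical strip if no row of it contains more than one box, and $|\lambda/\mu|$ is its number of boxes. Then $$\prod_{1\le i<j\le n}(1+x_i+x_j)=\sum_{\mu\subseteq\delta_{n-1}} r^{(n)}_\mu\, s_\mu(X_n),$$ $$\prod_{1\le i\le j\le n}(1+x_i+x_j)=\sum_{\lambda\subseteq\delta_n}\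 \sum_{\substack{\mu\subseteq\lambda\cap\delta_{n-1}\\ \lambda/\mu\ \text{a vertical strip}}} 2^{|\lambda/\mu|}\, r^{(n)}_\mu\, s_\lambda(X_n).$$ These identities hold over every commutative coefficient ring. -/

import Mathlib

namespace LascouxSchur

/-- The staircase partition `δ_m = (m, m - 1, …, 1)`; rows and columns of a Young diagram are
indexed from `0`, so its cells are the pairs `(i, j)` with `i + j < m`. -/
def staircase (m : ℕ) : YoungDiagram where
  cells := (Finset.range m ×ˢ Finset.range m).filter fun c => c.1 + c.2 < m
  isLowerSet := by
    rintro ⟨a, b⟩ ⟨c, d⟩ ⟨h1, h2⟩ h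
    simp only [Finset.coe_filter, Finset.mem_product, Finset.mem_range, Set.mem_ofPred_eq] at *
    omega

theorem mem_staircase {m : ℕ} {c : ℕ × ℕ} : c ∈ staircase m ↔ c.1 + c.2 < m := by
  rw [← YoungDiagram.mem_cells]
  simp only [staircase, Finset.mem_filter, Finset.mem_product, Finset.mem_range]
  omega

theorem finite_subdiagrams (ν : YoungDiagram) : {μ : YoungDiagram | μ ≤ ν}.Finite := by
  refine Set.Finite.of_finite_image (f := YoungDiagram.cells) ?_ ?_
  · refine (Finset.finite_toSet ν.cells.powerset).subset ?_
    rintro _ ⟨μ, hμ, rfl⟩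
    simpa using YoungDiagram.cells_subset_iff.2 hμ
  · intro μ _ μ' _ h
    exact YoungDiagram.ext h

/-- The partitions `μ ⊆ ν`. -/
noncomputable def subdiagrams (ν : YoungDiagram) : Finset YoungDiagram :=
  (finite_subdiagrams ν).toFinset

theorem mem_subdiagrams {μ ν : YoungDiagram} : μ ∈ subdiagrams ν ↔ μ ≤ ν := by
  simp [subdiagrams]

/-- Semistandard tableaux of shape `μ` whose entries are among the `n` smallest admissible letters.
Mathlib's tableaux have the letters `0, 1, 2, …`; letter `i` stands for `i + 1`. -/
abbrev BoundedSSYT (n : ℕ) (μ : YoungDiagram) : Type :=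
  {T : SemistandardYoungTableau μ // ∀ c ∈ μ, T c.1 c.2 < n}

instance finiteBoundedSSYT (n : ℕ) (μ : YoungDiagram) : Finite (BoundedSSYT n μ) := by
  refine Finite.of_injective
    (fun (T : BoundedSSYT n μ) (c : μ.cells) => (⟨T.1 c.1.1 c.1.2, T.2 c.1 c.2⟩ : Fin n)) ?_
  intro T T' h
  refine Subtype.ext (SemistandardYoungTableau.ext fun i j => ?_)
  by_cases hc : (i, j) ∈ μ
  · simpa using congrFun h ⟨(i, j), hc⟩
  · rw [T.1.zeros hc, T'.1.zeros hc]

noncomputable instance fintypeBoundedSSYT (n : ℕ) (μ : YoungDiagram) :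
    Fintype (BoundedSSYT n μ) :=
  Fintype.ofFinite _

/-- The Schur polynomial `s_μ(x_1, …, x_n) = ∑_T ∏_i x_i ^ (number of entries of T equal to i)`,
summed over the semistandard tableaux `T` of shape `μ` in `n` letters. -/
noncomputable def schurPoly (R : Type*) [CommRing R] (n : ℕ) (μ : YoungDiagram) :
    MvPolynomial (Fin n) R :=
  ∑ T : BoundedSSYT n μ,
    ∏ i : Fin n, MvPolynomial.X i ^ (μ.cells.filter fun c => T.1 c.1 c.2 = (i : ℕ)).card

/-- Reverse flagged fillings of shape `μ` with parameter `n`. The row with index `i` is the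
`(i + 1)`-st row of `μ`, so its entries lie in `[1, n - (i + 1)]` (an empty interval if
`n ≤ i + 1`). As for Mathlib's tableaux, a filling is a function on all pairs that vanishes
outside of `μ`. -/
@[ext]
structure ReverseFlaggedFilling (n : ℕ) (μ : YoungDiagram) where
  entry : ℕ → ℕ → ℕ
  row_strict : ∀ {i j1 j2 : ℕ}, j1 < j2 → (i, j2) ∈ μ → entry i j2 < entry i j1
  col_weak : ∀ {i1 i2 j : ℕ}, i1 < i2 → (i2, j) ∈ μ → entry i2 j ≤ entry i1 j
  flag : ∀ {i j : ℕ}, (i, j) ∈ μ → entry i j ∈ Set.Icc 1 (n - (i + 1))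
  zeros : ∀ {i j : ℕ}, (i, j) ∉ μ → entry i j = 0

instance finiteReverseFlaggedFilling (n : ℕ) (μ : YoungDiagram) :
    Finite (ReverseFlaggedFilling n μ) := by
  refine Finite.of_injective
    (fun (T : ReverseFlaggedFilling n μ) (c : μ.cells) =>
      (⟨T.entry c.1.1 c.1.2, by
        have h := (T.flag (i := c.1.1) (j := c.1.2) c.2).2
        omega⟩ : Fin (n + 1))) ?_
  intro T T' h
  ext i j
  by_cases hc : (i, j) ∈ μ
  · simpa using congrFun h ⟨(i, j), hc⟩
  · rw [T.zeros hc, T'.zeros hc]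

/-- `r^{(n)}_μ`, the number of reverse flagged fillings of shape `μ`. -/
noncomputable def reverseFlaggedCount (n : ℕ) (μ : YoungDiagram) : ℕ :=
  Nat.card (ReverseFlaggedFilling n μ)

/-- The set of boxes `ν / μ`. -/
def skewCells (ν μ : YoungDiagram) : Finset (ℕ × ℕ) :=
  ν.cells \ μ.cells

/-- `ν / μ` is a vertical strip: no row of it contains more than one box. -/
def IsVerticalStrip (ν μ : YoungDiagram) : Prop :=
  ∀ i : ℕ, ((skewCells ν μ).filter fun c => c.1 = i).card ≤ 1

noncomputable instance decidableIsVerticalStrip (ν μ : YoungDiagram) :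
    Decidable (IsVerticalStrip ν μ) :=
  Classical.propDecidable _

end LascouxSchur

namespace LascouxSchur

open Finset

/-! Put `y_i = x_i + x_i ^ 2`. Since `y_j - y_i = (x_j - x_i) * (1 + x_i + x_j)`, the Vandermonde
determinant in `y` is the one in `x` times the first product. It is also the determinant with
entries `x_i ^ j * (1 + x_i) ^ j`, and the proof strips the factors `1 + x_i` from it in rounds.

Each round takes one such factor from all columns that carry the largest remaining power of `1 +
x_i`. By multilinearity this adds vertical strips to the shapes of the remaining determinants, and
the shapes grow from `δ_{n-1}` to `δ_n` (`det_pieri`, `sum_det_pieri`). The coefficients obey the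
recursion of the reverse flagged fillings: deleting the entries `1` and lowering the others removes
a vertical strip and decreases the flag parameter (`reverseFlaggedCount_succ`). After the last round
only alternants remain (`det_vandermonde_add_sq_eq_sum`).

The second product has the extra factor `∏ (1 + 2 x_i)`; one more strip, now with weight `2`,
accounts for it.

Alternants become Schur polynomials by the bialternant formula, proved by removing the last variable
on both sides. The Vandermonde factor is cancelled in `ℤ[x_1, …, x_N]`, and the result is then
specialised to any ring. -/

theorem le_iff_rowLen_le {μ ν : YoungDiagram} : μ ≤ ν ↔ ∀ i, μ.rowLen i ≤ ν.rowLen i := by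
  constructor
  · intro h i
    by_contra! hlt
    exact absurd (YoungDiagram.mem_iff_lt_rowLen.1 (h (YoungDiagram.mem_iff_lt_rowLen.2 hlt)))
      (lt_irrefl _)
  · rintro h ⟨i, j⟩ hc
    exact YoungDiagram.mem_iff_lt_rowLen.2 ((YoungDiagram.mem_iff_lt_rowLen.1 hc).trans_le (h i))

theorem eq_of_rowLen_eq {μ ν : YoungDiagram} (h : ∀ i, μ.rowLen i = ν.rowLen i) : μ = ν :=
  le_antisymm (le_iff_rowLen_le.2 fun i => (h i).le) (le_iff_rowLen_le.2 fun i => (h i).ge)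

theorem rowLen_eq_zero_of_le {μ : YoungDiagram} {n i : ℕ} (h : μ.rowLen n = 0) (hi : n ≤ i) :
    μ.rowLen i = 0 := by
  have := μ.rowLen_anti n i hi
  omega

@[simp]
theorem rowLen_bot (i : ℕ) : (⊥ : YoungDiagram).rowLen i = 0 := by
  by_contra h
  exact YoungDiagram.notMem_bot _
    (YoungDiagram.mem_iff_lt_rowLen.2 (Nat.pos_of_ne_zero h) : (i, 0) ∈ (⊥ : YoungDiagram))

theorem eq_bot_of_rowLen_zero {μ : YoungDiagram} (h : μ.rowLen 0 = 0) : μ = ⊥ :=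
  eq_of_rowLen_eq fun i => by rw [rowLen_bot, rowLen_eq_zero_of_le h i.zero_le]

@[simp]
theorem rowLen_staircase (m i : ℕ) : (staircase m).rowLen i = m - i := by
  refine eq_of_forall_lt_iff fun j => ?_
  rw [← YoungDiagram.mem_iff_lt_rowLen, mem_staircase]
  dsimp only
  omega

/-- The Young diagram with at most `N` rows whose `i`-th row has length `f i`
(for `f` antitone on `{0, …, N - 1}`). -/
def rowDiagram (N : ℕ) (f : ℕ → ℕ) : YoungDiagram where
  cells := (range N ×ˢ range (f 0)).filter fun c => ∀ i ≤ c.1, c.2 < f i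
  isLowerSet := by
    rintro ⟨a, b⟩ ⟨c, d⟩ ⟨h1, h2⟩ h
    simp only [coe_filter, mem_product, mem_range, Set.mem_ofPred_eq] at *
    exact ⟨⟨by omega, by omega⟩, fun i hi => by have := h.2 i (by omega); omega⟩

theorem rowLen_rowDiagram {N : ℕ} {f : ℕ → ℕ} (hf : ∀ i j, i ≤ j → j < N → f j ≤ f i) (i : ℕ) :
    (rowDiagram N f).rowLen i = if i < N then f i else 0 := by
  refine eq_of_forall_lt_iff fun j => ?_
  rw [← YoungDiagram.mem_iff_lt_rowLen, ← YoungDiagram.mem_cells]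
  simp only [rowDiagram, mem_filter, mem_product, mem_range]
  split_ifs with h
  · exact ⟨fun hj => hj.2 i le_rfl, fun hj =>
      ⟨⟨h, hj.trans_le (hf 0 i i.zero_le h)⟩, fun k hk => hj.trans_le (hf k i hk h)⟩⟩
  · simp [h]

theorem card_skewCells_row (ν μ : YoungDiagram) (i : ℕ) :
    ((skewCells ν μ).filter fun c => c.1 = i).card = ν.rowLen i - μ.rowLen i := by
  rw [← Nat.card_Ico,
    ← card_map (s := Ico _ _) (Function.Embedding.sectR i ℕ)]
  refine congrArg Finset.card ?_
  ext ⟨a, b⟩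
  simp only [skewCells, mem_filter, mem_sdiff, YoungDiagram.mem_cells,
    YoungDiagram.mem_iff_lt_rowLen, mem_map, mem_Ico, Function.Embedding.sectR_apply, Prod.mk.injEq]
  constructor
  · rintro ⟨⟨h1, h2⟩, rfl⟩
    exact ⟨b, ⟨not_lt.1 h2, h1⟩, rfl, rfl⟩
  · rintro ⟨b, h, rfl, rfl⟩
    exact ⟨⟨h.2, not_lt.2 h.1⟩, rfl⟩

theorem isVerticalStrip_iff {ν μ : YoungDiagram} :
    IsVerticalStrip ν μ ↔ ∀ i, ν.rowLen i ≤ μ.rowLen i + 1 := by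
  simp only [IsVerticalStrip, card_skewCells_row]
  exact forall_congr' fun i => by omega

theorem card_skewCells {N : ℕ} {ν : YoungDiagram} (hν : ν.rowLen N = 0) (μ : YoungDiagram) :
    (skewCells ν μ).card = ∑ j : Fin N, (ν.rowLen j.rev - μ.rowLen j.rev) := by
  rw [card_eq_sum_card_fiberwise (f := Prod.fst) (t := range N)]
  · simp only [card_skewCells_row]
    rw [← Fin.sum_univ_eq_sum_range (fun i => ν.rowLen i - μ.rowLen i)]
    exact (Equiv.sum_comp Fin.revPerm (fun i : Fin N => ν.rowLen i - μ.rowLen i)).symm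
  · rintro ⟨a, b⟩ h
    simp only [skewCells, coe_sdiff, Set.mem_sdiff, mem_coe, YoungDiagram.mem_cells,
      YoungDiagram.mem_iff_lt_rowLen] at h
    simp only [coe_range, Set.mem_Iio]
    by_contra! hN
    have := rowLen_eq_zero_of_le hν hN
    omega

/-! ### Alternants and the removal of the last variable. -/

section Determinants

variable {A : Type*} [CommRing A]

/-- The strictly increasing sequence of exponents attached to a diagram with at most `N` rows. -/
def altExp (N : ℕ) (μ : YoungDiagram) (j : Fin N) : ℕ :=
  μ.rowLen j.rev + j

theorem altExp_strictMono (N : ℕ) (μ : YoungDiagram) : StrictMono (altExp N μ) := by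
  intro a b h
  have := μ.rowLen_anti b.rev a.rev (Fin.rev_le_rev.2 h.le)
  have h' : (a : ℕ) < b := h
  simp only [altExp]
  omega

/-- The alternant `det (x_i ^ (μ_j + N - j))`, its columns written in reverse order. -/
def alternant {N : ℕ} (x : Fin N → A) (μ : YoungDiagram) : A :=
  (Matrix.of fun i j => x i ^ altExp N μ j).det

theorem alternant_bot {N : ℕ} (x : Fin N → A) :
    alternant x ⊥ = (Matrix.vandermonde x).det := by
  simp only [alternant, altExp, rowLen_bot, zero_add]
  rfl

/-- With `t` the last variable, subtracting from each column a power of `t` times its predecessor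
clears the last row except for its first entry. In the remaining minor, row `i` is divisible by `x_i
- t`; the quotients are geometric sums, and multilinearity in the columns chooses one exponent `β j`
from each. -/
theorem det_pow_branching {n : ℕ} (x : Fin (n + 1) → A) (α : Fin (n + 1) → ℕ)
    (hα : StrictMono α) :
    (Matrix.of fun i j => x i ^ α j).det =
      (∏ i : Fin n, (x (Fin.last n) - x i.castSucc)) * x (Fin.last n) ^ α 0 *
        ∑ β ∈ Fintype.piFinset fun j : Fin n => Ico (α j.castSucc) (α j.succ),
          x (Fin.last n) ^ (∑ j : Fin n, (α j.succ - 1 - β j)) *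
            (Matrix.of fun i j : Fin n => x i.castSucc ^ β j).det := by
  set t := x (Fin.last n) with ht
  let B : Matrix (Fin (n + 1)) (Fin (n + 1)) A := Matrix.of fun i =>
    Fin.cons (x i ^ α 0) fun j : Fin n =>
      x i ^ α j.succ - t ^ (α j.succ - α j.castSucc) * x i ^ α j.castSucc
  have hB : (Matrix.of fun i j => x i ^ α j).det = B.det := by
    refine Matrix.det_eq_of_forall_col_eq_smul_add_pred
      (fun j => t ^ (α j.succ - α j.castSucc)) ?_ ?_
    · intro i
      simp [B]
    · intro i j
      simp [B]
  have hlast : ∀ j : Fin n, B (Fin.last n) j.succ = 0 := by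
    intro j
    have := (hα (Fin.castSucc_lt_succ (i := j))).le
    simp only [B, Matrix.of_apply, Fin.cons_succ, ← ht, ← pow_add]
    rw [Nat.sub_add_cancel this, sub_self]
  rw [hB, Matrix.det_succ_row B (Fin.last n), Fin.sum_univ_succ, sum_eq_zero, add_zero]
  swap
  · intro j _
    rw [hlast, mul_zero, zero_mul]
  have hsub : B.submatrix (Fin.last n).succAbove (Fin.succAbove 0) =
      Matrix.of fun i j => (x i.castSucc - t) * (Matrix.of fun i j : Fin n =>
        ∑ b ∈ Ico (α j.castSucc) (α j.succ), t ^ (α j.succ - 1 - b) * x i.castSucc ^ b) i j := by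
    ext i j
    have := (hα (Fin.castSucc_lt_succ (i := j))).le
    simp only [Matrix.submatrix_apply, Fin.succAbove_last, Fin.succAbove_zero, B,
      Matrix.of_apply, Fin.cons_succ]
    rw [← (Commute.all (x i.castSucc) t).geom_sum₂_Ico_mul this, mul_comm]
    simp only [mul_comm]
  have hexp : (Matrix.of fun i j : Fin n =>
        ∑ b ∈ Ico (α j.castSucc) (α j.succ), t ^ (α j.succ - 1 - b) * x i.castSucc ^ b).det =
      ∑ β ∈ Fintype.piFinset fun j : Fin n => Ico (α j.castSucc) (α j.succ),
        t ^ (∑ j : Fin n, (α j.succ - 1 - β j)) *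
          (Matrix.of fun i j : Fin n => x i.castSucc ^ β j).det := by
    rw [← Matrix.det_transpose]
    have := (Matrix.detRowAlternating (R := A) (n := Fin n)).toMultilinearMap.map_sum_finset
      (fun (j : Fin n) (b : ℕ) (i : Fin n) => t ^ (α j.succ - 1 - b) * x i.castSucc ^ b)
      (fun j => Ico (α j.castSucc) (α j.succ))
    refine Eq.trans ?_ (this.trans (sum_congr rfl fun β _ => ?_))
    · refine congrArg Matrix.det ?_
      ext j i
      simp [Matrix.transpose_apply]
    · rw [← prod_pow_eq_pow_sum, ← Matrix.det_transpose, ← Matrix.det_mul_column]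
      rfl
  rw [hsub, Matrix.det_mul_column, hexp]
  -- The cofactor sign is `(-1) ^ n`, exactly what reverses the `n` differences.
  have hsign : (-1 : A) ^ ((Fin.last n : ℕ) + ((0 : Fin (n + 1)) : ℕ)) *
      ∏ i : Fin n, (x i.castSucc - t) = ∏ i : Fin n, (t - x i.castSucc) := by
    rw [Fin.val_last, Fin.val_zero, add_zero]
    calc _ = ∏ i : Fin n, (-1 : A) * (x i.castSucc - t) := by
          rw [prod_mul_distrib]; simp
      _ = _ := prod_congr rfl fun i _ => by ring
  rw [← hsign]
  simp only [B, Matrix.of_apply, Fin.cons_zero, ← ht]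
  ring

end Determinants

/-! ### Branching of tableaux and of alternants; the bialternant formula. -/

section Branching

variable {n : ℕ} {μ ν : YoungDiagram}

namespace BoundedSSYT

/-- The shape formed by the entries of a tableau other than the largest admissible letter. -/
def smallShape (T : BoundedSSYT (n + 1) μ) : YoungDiagram where
  cells := μ.cells.filter fun c => T.1 c.1 c.2 < n
  isLowerSet := by
    rintro ⟨a, b⟩ ⟨c, d⟩ ⟨h1, h2⟩ h
    simp only [coe_filter, YoungDiagram.mem_cells, Set.mem_ofPred_eq] at *
    have hab := h.1
    have hcb : (c, b) ∈ μ := μ.up_left_mem h1 le_rfl hab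
    exact ⟨μ.up_left_mem h1 h2 hab,
      ((T.1.row_weak_of_le h2 hcb).trans (T.1.col_weak h1 hab)).trans_lt h.2⟩

theorem mem_smallShape {T : BoundedSSYT (n + 1) μ} {i j : ℕ} :
    (i, j) ∈ smallShape T ↔ (i, j) ∈ μ ∧ T.1 i j < n := by
  rw [← YoungDiagram.mem_cells]
  simp [smallShape]

theorem row_le (T : BoundedSSYT n μ) {i j : ℕ} (h : (i, j) ∈ μ) : i ≤ T.1 i j := by
  induction i with
  | zero => exact Nat.zero_le _
  | succ i ih =>
    have := ih (μ.up_left_mem i.le_succ le_rfl h)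
    have := T.1.col_strict i.lt_add_one h
    omega

/-- Restriction of a tableau to the cells that do not carry the largest admissible letter. -/
def restrict (T : BoundedSSYT (n + 1) μ) (h : smallShape T = ν) : BoundedSSYT n ν :=
  ⟨{ entry := fun i j => if (i, j) ∈ ν then T.1 i j else 0
     row_weak' := fun {i j1 j2} hj hc => by
      have hc' := hc
      rw [← h, mem_smallShape] at hc'
      rw [if_pos hc, if_pos (ν.up_left_mem le_rfl hj.le hc)]
      exact T.1.row_weak hj hc'.1
     col_strict' := fun {i1 i2 j} hi hc => by
      have hc' := hc
      rw [← h, mem_smallShape] at hc'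
      rw [if_pos hc, if_pos (ν.up_left_mem hi.le le_rfl hc)]
      exact T.1.col_strict hi hc'.1
     zeros' := fun hc => if_neg hc },
   fun ⟨i, j⟩ hc => by
    have hc' := hc
    rw [← h, mem_smallShape] at hc'
    change (if (i, j) ∈ ν then T.1 i j else 0) < n
    rw [if_pos hc]
    exact hc'.2⟩

theorem restrict_apply (T : BoundedSSYT (n + 1) μ) (h : smallShape T = ν) (i j : ℕ) :
    (restrict T h).1 i j = if (i, j) ∈ ν then T.1 i j else 0 := rfl

/-- Extension of a tableau by the largest admissible letter along a horizontal strip. -/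
def extend (hle : ν ≤ μ) (hs : ∀ i j, (i + 1, j) ∈ μ → (i, j) ∈ ν) (S : BoundedSSYT n ν) :
    BoundedSSYT (n + 1) μ :=
  ⟨{ entry := fun i j => if (i, j) ∈ ν then S.1 i j else if (i, j) ∈ μ then n else 0
     row_weak' := fun {i j1 j2} hj hc => by
      have h1 : (i, j1) ∈ μ := μ.up_left_mem le_rfl hj.le hc
      by_cases hν : (i, j2) ∈ ν
      · rw [if_pos hν, if_pos (ν.up_left_mem le_rfl hj.le hν)]
        exact S.1.row_weak hj hν
      · rw [if_neg hν, if_pos hc]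
        split_ifs with h2
        · exact (S.2 _ h2).le
        · exact le_rfl
     col_strict' := fun {i1 i2 j} hi hc => by
      have h1 : (i1, j) ∈ ν := hs i1 j (μ.up_left_mem hi le_rfl hc)
      rw [if_pos h1]
      split_ifs with h2
      · exact S.1.col_strict hi h2
      · exact S.2 _ h1
     zeros' := fun {i j} hc => by rw [if_neg fun h => hc (hle h), if_neg hc] },
   fun ⟨i, j⟩ hc => by
    change (if (i, j) ∈ ν then S.1 i j else if (i, j) ∈ μ then n else 0) < n + 1
    split_ifs with h1
    · exact (S.2 _ h1).trans n.lt_succ_self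
    · exact n.lt_succ_self⟩

theorem extend_apply (hle : ν ≤ μ) (hs : ∀ i j, (i + 1, j) ∈ μ → (i, j) ∈ ν)
    (S : BoundedSSYT n ν) (i j : ℕ) : (extend hle hs S).1 i j =
      if (i, j) ∈ ν then S.1 i j else if (i, j) ∈ μ then n else 0 := rfl

theorem smallShape_extend (hle : ν ≤ μ) (hs : ∀ i j, (i + 1, j) ∈ μ → (i, j) ∈ ν)
    (S : BoundedSSYT n ν) : smallShape (extend hle hs S) = ν := by
  refine SetLike.ext ?_
  rintro ⟨i, j⟩
  rw [mem_smallShape, extend_apply]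
  constructor
  · rintro ⟨h1, h2⟩
    by_contra h
    simp [h, h1] at h2
  · intro h
    rw [if_pos h]
    exact ⟨hle h, S.2 _ h⟩

theorem restrict_extend (hle : ν ≤ μ) (hs : ∀ i j, (i + 1, j) ∈ μ → (i, j) ∈ ν)
    (S : BoundedSSYT n ν) : restrict (extend hle hs S) (smallShape_extend hle hs S) = S := by
  refine Subtype.ext (SemistandardYoungTableau.ext fun i j => ?_)
  rw [restrict_apply, extend_apply]
  split_ifs with h
  · rfl
  · exact (S.1.zeros h).symm

theorem extend_restrict (hle : ν ≤ μ) (hs : ∀ i j, (i + 1, j) ∈ μ → (i, j) ∈ ν)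
    (T : BoundedSSYT (n + 1) μ) (h : smallShape T = ν) : extend hle hs (restrict T h) = T := by
  refine Subtype.ext (SemistandardYoungTableau.ext fun i j => ?_)
  rw [extend_apply, restrict_apply]
  split_ifs with h1 h2
  · rfl
  · rw [← h, mem_smallShape, not_and] at h1
    have h3 := T.2 _ h2
    have := h1 h2
    dsimp only at h3
    omega
  · exact (T.1.zeros h2).symm

end BoundedSSYT

open Classical in
/-- The diagrams `ν` with at most `n` rows such that `μ / ν` is a horizontal strip. -/
noncomputable def horizontalStrips (n : ℕ) (μ : YoungDiagram) : Finset YoungDiagram :=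
  (subdiagrams μ).filter fun ν => (∀ i, μ.rowLen (i + 1) ≤ ν.rowLen i) ∧ ν.rowLen n = 0

theorem mem_horizontalStrips : ν ∈ horizontalStrips n μ ↔
    ν ≤ μ ∧ (∀ i, μ.rowLen (i + 1) ≤ ν.rowLen i) ∧ ν.rowLen n = 0 := by
  simp only [horizontalStrips, mem_filter, mem_subdiagrams]

/-- Strict columns allow the largest letter at most once per column, and they force an entry in row
`i` to be at least `i`, so letters below `n` stay in the first `n` rows. -/
theorem smallShape_mem_horizontalStrips (T : BoundedSSYT (n + 1) μ) :
    T.smallShape ∈ horizontalStrips n μ := by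
  refine mem_horizontalStrips.2 ⟨?_, ?_, ?_⟩
  · rintro ⟨i, j⟩ h
    exact (BoundedSSYT.mem_smallShape.1 h).1
  · intro i
    by_contra! h
    have h1 := YoungDiagram.mem_iff_lt_rowLen.2 h
    have h2 := T.1.col_strict i.lt_add_one h1
    have h3 := T.2 _ h1
    dsimp only at h3
    exact absurd (YoungDiagram.mem_iff_lt_rowLen.1
      (BoundedSSYT.mem_smallShape.2 ⟨μ.up_left_mem i.le_succ le_rfl h1, by omega⟩)) (lt_irrefl _)
  · by_contra h
    have h1 := BoundedSSYT.mem_smallShape.1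
      (YoungDiagram.mem_iff_lt_rowLen.2 (Nat.pos_of_ne_zero h))
    have := T.row_le h1.1
    omega

variable {A : Type*} [CommRing A]

/-- The value of a Schur polynomial at a point of a commutative ring. -/
noncomputable def schurEval (x : Fin n → A) (μ : YoungDiagram) : A :=
  ∑ T : BoundedSSYT n μ,
    ∏ i : Fin n, x i ^ (μ.cells.filter fun c => T.1 c.1 c.2 = (i : ℕ)).card

/-- Tableaux are grouped by the shape left after deleting the largest letter; within a group the
deletion is a bijection, undone by refilling the strip. -/
theorem schurEval_branching (x : Fin (n + 1) → A) (μ : YoungDiagram) :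
    schurEval x μ = ∑ ν ∈ horizontalStrips n μ,
      x (Fin.last n) ^ (skewCells μ ν).card * schurEval (fun i => x i.castSucc) ν := by
  classical
  rw [schurEval, ← sum_fiberwise_of_maps_to (g := BoundedSSYT.smallShape)
    (t := horizontalStrips n μ) fun T _ => smallShape_mem_horizontalStrips T]
  refine sum_congr rfl fun ν hν => ?_
  obtain ⟨hle, hs', -⟩ := mem_horizontalStrips.1 hν
  have hs : ∀ i j, (i + 1, j) ∈ μ → (i, j) ∈ ν := fun i j h =>
    YoungDiagram.mem_iff_lt_rowLen.2 ((YoungDiagram.mem_iff_lt_rowLen.1 h).trans_le (hs' i))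
  rw [schurEval, mul_sum]
  refine sum_bij' (fun T hT => T.restrict (mem_filter.1 hT).2)
    (fun S _ => S.extend hle hs) (fun _ _ => mem_univ _)
    (fun S _ => mem_filter.2 ⟨mem_univ _, BoundedSSYT.smallShape_extend hle hs S⟩)
    (fun T hT => BoundedSSYT.extend_restrict hle hs T _)
    (fun S _ => BoundedSSYT.restrict_extend hle hs S) ?_
  intro T hT
  have hT' := (mem_filter.1 hT).2
  have key : ∀ {i j}, (i, j) ∈ ν ↔ (i, j) ∈ μ ∧ T.1 i j < n := fun {i j} => by
    rw [← hT', BoundedSSYT.mem_smallShape]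
  rw [Fin.prod_univ_castSucc, mul_comm]
  congr 1
  · refine congrArg (fun s : Finset (ℕ × ℕ) => x (Fin.last n) ^ s.card) ?_
    ext ⟨i, j⟩
    simp only [skewCells, mem_filter, mem_sdiff, YoungDiagram.mem_cells, key, Fin.val_last]
    refine and_congr_right fun h => ?_
    have := T.2 _ h
    dsimp only at this
    simp only [h, true_and]
    omega
  · refine prod_congr rfl fun k _ =>
      congrArg (fun s : Finset (ℕ × ℕ) => x k.castSucc ^ s.card) ?_
    ext ⟨i, j⟩
    rw [mem_filter, mem_filter]
    simp only [YoungDiagram.mem_cells, BoundedSSYT.restrict_apply, Fin.val_castSucc]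
    have hk := k.2
    constructor
    · rintro ⟨h1, h2⟩
      have h3 : (i, j) ∈ ν := key.2 ⟨h1, by omega⟩
      exact ⟨h3, by rw [if_pos h3, h2]⟩
    · rintro ⟨h1, h2⟩
      rw [if_pos h1] at h2
      exact ⟨(key.1 h1).1, h2⟩

theorem schurEval_bot (x : Fin 0 → A) : schurEval x ⊥ = 1 := by
  have : Unique (BoundedSSYT 0 ⊥) :=
    { default := ⟨SemistandardYoungTableau.highestWeight ⊥,
        fun c hc => absurd hc (YoungDiagram.notMem_bot c)⟩
      uniq := fun T => Subtype.ext (SemistandardYoungTableau.ext fun i j => by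
        rw [T.1.zeros (YoungDiagram.notMem_bot _)]
        exact (SemistandardYoungTableau.zeros _ (YoungDiagram.notMem_bot _)).symm) }
  simp [schurEval]

/-- The exponents `β` in `det_pow_branching` satisfy `μ_{i+1} + j ≤ β j ≤ μ_i + j` for the row `i =
j.rev`. Subtracting `j` turns this into the interlacing condition that defines a horizontal strip.
-/
theorem alternant_branching (x : Fin (n + 1) → A) (hμ : μ.rowLen (n + 1) = 0) :
    alternant x μ = (∏ i : Fin n, (x (Fin.last n) - x i.castSucc)) *
      ∑ ν ∈ horizontalStrips n μ, x (Fin.last n) ^ (skewCells μ ν).card *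
        alternant (fun i => x i.castSucc) ν := by
  rw [alternant, det_pow_branching x _ (altExp_strictMono _ _), mul_assoc, mul_sum]
  congr 1
  have hsucc : ∀ j : Fin n, altExp (n + 1) μ j.succ = μ.rowLen j.rev + j + 1 := by
    intro j
    simp [altExp, Fin.rev_succ, add_assoc]
  have hcast : ∀ j : Fin n, altExp (n + 1) μ j.castSucc = μ.rowLen (j.rev + 1) + j := by
    intro j
    simp [altExp, Fin.rev_castSucc]
  have hrows : ∀ β ∈ Fintype.piFinset fun j : Fin n =>
      Ico (altExp (n + 1) μ j.castSucc) (altExp (n + 1) μ j.succ), ∀ j : Fin n,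
        μ.rowLen (j.rev + 1) + j ≤ β j ∧ β j ≤ μ.rowLen j.rev + j := by
    intro β hβ j
    have := mem_Ico.1 (Fintype.mem_piFinset.1 hβ j)
    rw [hcast, hsucc] at this
    omega
  -- Recovers row lengths from exponents: row `i` belongs to column `n - 1 - i`, whose index is the
  -- staircase shift.
  let f : (Fin n → ℕ) → ℕ → ℕ := fun β i =>
    if h : i < n then β (Fin.rev ⟨i, h⟩) - (n - 1 - i) else 0
  have hf : ∀ (β : Fin n → ℕ) (i : ℕ) (h : i < n),
      f β i = β (Fin.rev ⟨i, h⟩) - (n - 1 - i) := fun β i h => dif_pos h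
  have hinter : ∀ β ∈ Fintype.piFinset fun j : Fin n =>
      Ico (altExp (n + 1) μ j.castSucc) (altExp (n + 1) μ j.succ), ∀ i < n,
        μ.rowLen (i + 1) ≤ f β i ∧ f β i ≤ μ.rowLen i := by
    intro β hβ i hi
    have := hrows β hβ (Fin.rev ⟨i, hi⟩)
    rw [Fin.rev_rev, Fin.val_rev] at this
    dsimp only at this
    rw [hf β i hi]
    omega
  have hlen : ∀ β ∈ Fintype.piFinset fun j : Fin n =>
      Ico (altExp (n + 1) μ j.castSucc) (altExp (n + 1) μ j.succ), ∀ i,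
        (rowDiagram n (f β)).rowLen i = if i < n then f β i else 0 := by
    intro β hβ
    refine rowLen_rowDiagram fun i j hij hj => ?_
    rcases hij.eq_or_lt with rfl | hlt
    · rfl
    · have h1 := hinter β hβ i (by omega)
      have h2 := hinter β hβ j hj
      have h3 := μ.rowLen_anti (i + 1) j hlt
      omega
  have hexp : ∀ β ∈ Fintype.piFinset fun j : Fin n =>
      Ico (altExp (n + 1) μ j.castSucc) (altExp (n + 1) μ j.succ),
        altExp n (rowDiagram n (f β)) = β := by
    intro β hβ
    funext j
    have h1 := hrows β hβ j
    rw [altExp, hlen β hβ, if_pos j.rev.2, hf β _ j.rev.2, Fin.eta, Fin.rev_rev, Fin.val_rev]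
    omega
  refine sum_bij' (fun β _ => rowDiagram n (f β)) (fun ν _ => altExp n ν) ?_ ?_ hexp ?_ ?_
  · intro β hβ
    refine mem_horizontalStrips.2 ⟨le_iff_rowLen_le.2 fun i => ?_, fun i => ?_, ?_⟩
    · rw [hlen β hβ]
      split_ifs with h
      · exact (hinter β hβ i h).2
      · exact Nat.zero_le _
    · rw [hlen β hβ]
      split_ifs with h
      · exact (hinter β hβ i h).1
      · exact (rowLen_eq_zero_of_le hμ (by omega)).le
    · rw [hlen β hβ, if_neg (lt_irrefl n)]
  · intro ν hν
    obtain ⟨h1, h2, -⟩ := mem_horizontalStrips.1 hν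
    refine Fintype.mem_piFinset.2 fun j => mem_Ico.2 ?_
    have h3 := h2 j.rev
    have h4 := le_iff_rowLen_le.1 h1 j.rev
    rw [hcast, hsucc, altExp]
    omega
  · intro ν hν
    obtain ⟨h1, h2, h3⟩ := mem_horizontalStrips.1 hν
    have hfν : ∀ i, i < n → f (altExp n ν) i = ν.rowLen i := by
      intro i hi
      rw [hf _ i hi, altExp, Fin.rev_rev, Fin.val_rev]
      dsimp only
      omega
    refine eq_of_rowLen_eq fun i => ?_
    rw [rowLen_rowDiagram]
    · split_ifs with h
      · exact hfν i h
      · exact (rowLen_eq_zero_of_le h3 (by omega)).symm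
    · intro i j hij hj
      rw [hfν i (by omega), hfν j hj]
      exact ν.rowLen_anti i j hij
  · intro β hβ
    rw [← mul_assoc, ← pow_add, alternant, hexp β hβ]
    congr 2
    -- Column `0` stands for row `n` of `μ`, which lies wholly in the strip and accounts for the
    -- separate factor `x (Fin.last n) ^ α 0`.
    rw [card_skewCells hμ, Fin.sum_univ_succ]
    congr 1
    · rw [altExp, hlen β hβ, if_neg (by simp)]
      simp
    · refine sum_congr rfl fun j _ => ?_
      have h1 := hrows β hβ j
      rw [hsucc, Fin.rev_succ, Fin.val_castSucc, hlen β hβ, if_pos j.rev.2, hf β _ j.rev.2,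
        Fin.eta, Fin.rev_rev, Fin.val_rev]
      omega

/-- The bialternant formula for Schur polynomials defined by semistandard tableaux. -/
theorem alternant_eq_vandermonde_mul_schurEval (x : Fin n → A) (hμ : μ.rowLen n = 0) :
    alternant x μ = (Matrix.vandermonde x).det * schurEval x μ := by
  induction n generalizing μ with
  | zero =>
    rw [eq_bot_of_rowLen_zero hμ, alternant_bot, schurEval_bot, mul_one]
  | succ n ih =>
    -- The Vandermonde recursion is the case of the empty shape, whose only horizontal strip is
    -- empty.
    have hv : (Matrix.vandermonde x).det = (∏ i : Fin n, (x (Fin.last n) - x i.castSucc)) *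
        (Matrix.vandermonde fun i : Fin n => x i.castSucc).det := by
      have hbot : horizontalStrips n ⊥ = {⊥} := by
        ext ν
        simp +contextual [mem_horizontalStrips, le_bot_iff]
      rw [← alternant_bot, alternant_branching x (rowLen_bot _), hbot, sum_singleton,
        alternant_bot]
      simp [skewCells]
    rw [alternant_branching x hμ, schurEval_branching, hv, mul_assoc]
    congr 1
    rw [mul_sum]
    refine sum_congr rfl fun ν hν => ?_
    rw [ih _ (mem_horizontalStrips.1 hν).2.2]
    ring

end Branching

/-! ### Recursion for reverse flagged fillings. -/

section ReverseFlagged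

variable {n : ℕ} {μ ν : YoungDiagram}

namespace ReverseFlaggedFilling

/-- The shape formed by the entries of a reverse flagged filling that are greater than `1`. -/
def largeShape (T : ReverseFlaggedFilling n μ) : YoungDiagram where
  cells := μ.cells.filter fun c => 1 < T.entry c.1 c.2
  isLowerSet := by
    rintro ⟨a, b⟩ ⟨c, d⟩ ⟨h1, h2⟩ h
    simp only [coe_filter, YoungDiagram.mem_cells, Set.mem_ofPred_eq] at *
    have hab := h.1
    have hcb : (c, b) ∈ μ := μ.up_left_mem h1 le_rfl hab
    refine ⟨μ.up_left_mem h1 h2 hab, h.2.trans_le (le_trans (b := T.entry c b) ?_ ?_)⟩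
    · rcases h1.eq_or_lt with rfl | hlt
      · exact le_rfl
      · exact T.col_weak hlt hab
    · rcases h2.eq_or_lt with rfl | hlt
      · exact le_rfl
      · exact (T.row_strict hlt hcb).le

theorem mem_largeShape {T : ReverseFlaggedFilling n μ} {i j : ℕ} :
    (i, j) ∈ T.largeShape ↔ (i, j) ∈ μ ∧ 1 < T.entry i j := by
  rw [← YoungDiagram.mem_cells]
  simp [largeShape]

/-- Remove the entries `1` of a filling and decrease the other entries by `1`. -/
def lower (T : ReverseFlaggedFilling (n + 1) μ) (h : T.largeShape = ν) :
    ReverseFlaggedFilling n ν where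
  entry i j := if (i, j) ∈ ν then T.entry i j - 1 else 0
  row_strict {i j1 j2} hj hc := by
    have hc1 := ν.up_left_mem le_rfl hj.le hc
    rw [if_pos hc, if_pos hc1]
    rw [← h, mem_largeShape] at hc hc1
    have := T.row_strict hj hc.1
    omega
  col_weak {i1 i2 j} hi hc := by
    have hc1 := ν.up_left_mem hi.le le_rfl hc
    rw [if_pos hc, if_pos hc1]
    rw [← h, mem_largeShape] at hc hc1
    have := T.col_weak hi hc.1
    omega
  flag {i j} hc := by
    rw [if_pos hc]
    rw [← h, mem_largeShape] at hc
    have h1 := (T.flag hc.1).2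
    have h2 := hc.2
    exact ⟨by omega, by omega⟩
  zeros hc := if_neg hc

/-- Increase the entries of a filling by `1` and put entries `1` along a vertical strip. -/
def raise (hs : ∀ i j j', j < j' → (i, j') ∈ μ → (i, j) ∈ ν)
    (hμ : ∀ i j, (i, j) ∈ μ → i < n) (S : ReverseFlaggedFilling n ν) :
    ReverseFlaggedFilling (n + 1) μ where
  -- On `μ / ν` the filling `S` has its default value `0`, so these boxes receive `1`.
  entry i j := if (i, j) ∈ μ then S.entry i j + 1 else 0
  row_strict {i j1 j2} hj hc := by
    rw [if_pos hc, if_pos (μ.up_left_mem le_rfl hj.le hc)]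
    by_cases h : (i, j2) ∈ ν
    · exact Nat.succ_lt_succ (S.row_strict hj h)
    · rw [S.zeros h]
      exact Nat.succ_lt_succ (S.flag (hs i j1 j2 hj hc)).1
  col_weak {i1 i2 j} hi hc := by
    rw [if_pos hc, if_pos (μ.up_left_mem hi.le le_rfl hc)]
    by_cases h : (i2, j) ∈ ν
    · exact Nat.succ_le_succ (S.col_weak hi h)
    · rw [S.zeros h]
      omega
  flag {i j} hc := by
    rw [if_pos hc]
    have hi := hμ i j hc
    by_cases h : (i, j) ∈ ν
    · have := (S.flag h).2
      exact ⟨by omega, by omega⟩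
    · rw [S.zeros h]
      exact ⟨by omega, by omega⟩
  zeros hc := if_neg hc

theorem largeShape_raise (hle : ν ≤ μ) (hs : ∀ i j j', j < j' → (i, j') ∈ μ → (i, j) ∈ ν)
    (hμ : ∀ i j, (i, j) ∈ μ → i < n) (S : ReverseFlaggedFilling n ν) :
    (raise hs hμ S).largeShape = ν := by
  refine SetLike.ext ?_
  rintro ⟨i, j⟩
  rw [mem_largeShape]
  constructor
  · rintro ⟨h1, h2⟩
    by_contra h
    simp [raise, h1, S.zeros h] at h2
  · intro h
    have : 0 < S.entry i j := (S.flag h).1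
    exact ⟨hle h, by simpa [raise, show (i, j) ∈ μ from hle h] using this⟩

/-- Fillings whose entries greater than `1` form a given shape. -/
def fiberEquiv (hle : ν ≤ μ) (hs : ∀ i j j', j < j' → (i, j') ∈ μ → (i, j) ∈ ν)
    (hμ : ∀ i j, (i, j) ∈ μ → i < n) :
    {T : ReverseFlaggedFilling (n + 1) μ // T.largeShape = ν} ≃ ReverseFlaggedFilling n ν where
  toFun T := T.1.lower T.2
  invFun S := ⟨S.raise hs hμ, largeShape_raise hle hs hμ S⟩
  left_inv := by
    rintro ⟨T, h⟩
    refine Subtype.ext (ReverseFlaggedFilling.ext (funext fun i => funext fun j => ?_))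
    change (if (i, j) ∈ μ then (if (i, j) ∈ ν then T.entry i j - 1 else 0) + 1 else 0) = T.entry i j
    by_cases h1 : (i, j) ∈ μ
    · have h2 := (T.flag h1).1
      have h3 : (i, j) ∈ ν ↔ 1 < T.entry i j := by
        rw [← h, mem_largeShape]
        exact and_iff_right h1
      rw [if_pos h1]
      split_ifs with h4
      · omega
      · rw [h3] at h4
        omega
    · rw [if_neg h1, T.zeros h1]
  right_inv S := by
    refine ReverseFlaggedFilling.ext (funext fun i => funext fun j => ?_)
    change (if (i, j) ∈ ν then (if (i, j) ∈ μ then S.entry i j + 1 else 0) - 1 else 0) = _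
    split_ifs with h1 h2
    · rfl
    · exact absurd (hle h1) h2
    · exact (S.zeros h1).symm

end ReverseFlaggedFilling

/-- Strict rows contain at most one `1`, so the boxes with entry `1` form a vertical strip.
Conversely such a strip can be filled with `1`s because every row of `μ` has index below `n`, where
the flag interval is nonempty. -/
theorem reverseFlaggedCount_succ (hμ : μ.rowLen n = 0) :
    reverseFlaggedCount (n + 1) μ =
      ∑ ν ∈ subdiagrams μ with IsVerticalStrip μ ν, reverseFlaggedCount n ν := by
  have hrow : ∀ i j, (i, j) ∈ μ → i < n := by
    intro i j h
    by_contra! hi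
    have := YoungDiagram.mem_iff_lt_rowLen.1 h
    have := rowLen_eq_zero_of_le hμ hi
    omega
  let V := (subdiagrams μ).filter fun ν => IsVerticalStrip μ ν
  have hmem : ∀ T : ReverseFlaggedFilling (n + 1) μ, T.largeShape ∈ V := by
    intro T
    refine mem_filter.2 ⟨mem_subdiagrams.2 fun c hc =>
      (ReverseFlaggedFilling.mem_largeShape.1 hc).1, isVerticalStrip_iff.2 fun i => ?_⟩
    by_contra! h
    have h1 := YoungDiagram.mem_iff_lt_rowLen.2 h
    have h2 := T.row_strict (Nat.lt_succ_self _) h1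
    have h3 := (T.flag h1).1
    exact absurd (YoungDiagram.mem_iff_lt_rowLen.1 (ReverseFlaggedFilling.mem_largeShape.2
      ⟨μ.up_left_mem le_rfl (Nat.le_succ _) h1, h3.trans_lt h2⟩)) (lt_irrefl _)
  let g : ReverseFlaggedFilling (n + 1) μ → V := fun T => ⟨T.largeShape, hmem T⟩
  rw [reverseFlaggedCount, ← Nat.card_congr (Equiv.sigmaFiberEquiv g), Nat.card_sigma]
  refine Eq.trans (sum_congr rfl fun ν _ => ?_) (sum_coe_sort V fun ν => reverseFlaggedCount n ν)
  obtain ⟨hν1, hν2⟩ := mem_filter.1 ν.2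
  refine Nat.card_congr ((Equiv.subtypeEquivRight fun T => Subtype.ext_iff).trans
    (ReverseFlaggedFilling.fiberEquiv (mem_subdiagrams.1 hν1) ?_ hrow))
  intro i j j' hj h
  have h1 := isVerticalStrip_iff.1 hν2 i
  have h2 := YoungDiagram.mem_iff_lt_rowLen.1 h
  exact YoungDiagram.mem_iff_lt_rowLen.2 (by omega)

/-- A box `(i, j)` forces the first entry of its row to be at least `j + 1`, while the flag bounds
that entry by `n - (i + 1)`. -/
theorem reverseFlaggedCount_eq_zero (h : ¬ μ ≤ staircase (n - 1)) :
    reverseFlaggedCount n μ = 0 := by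
  have : IsEmpty (ReverseFlaggedFilling n μ) := by
    refine ⟨fun T => h ?_⟩
    rintro ⟨i, j⟩ hc
    have key : ∀ k ≤ j, T.entry i j + k ≤ T.entry i (j - k) := by
      intro k hk
      induction k with
      | zero => exact le_rfl
      | succ k ih =>
        have h1 := ih (by omega)
        have h2 := T.row_strict (i := i) (j1 := j - (k + 1)) (j2 := j - k) (by omega)
          (μ.up_left_mem le_rfl (by omega) hc)
        omega
    have h1 := key j le_rfl
    have h2 := (T.flag hc).1
    rw [Nat.sub_self] at h1
    have h3 := (T.flag (μ.up_left_mem le_rfl (Nat.zero_le j) hc)).2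
    rw [mem_staircase]
    dsimp only
    omega
  exact Nat.card_eq_zero.2 (Or.inl this)

theorem reverseFlaggedCount_bot (n : ℕ) : reverseFlaggedCount n ⊥ = 1 := by
  refine Nat.card_eq_one_iff_unique.2 ⟨⟨fun T T' => ?_⟩, ⟨?_⟩⟩
  · ext i j
    rw [T.zeros (YoungDiagram.notMem_bot _), T'.zeros (YoungDiagram.notMem_bot _)]
  · exact
      { entry := fun _ _ => 0
        row_strict := fun _ h => absurd h (YoungDiagram.notMem_bot _)
        col_weak := fun _ h => absurd h (YoungDiagram.notMem_bot _)
        flag := fun h => absurd h (YoungDiagram.notMem_bot _)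
        zeros := fun _ => rfl }

end ReverseFlagged

/-! ### Multiplying columns of an alternant by linear factors. -/

section Pieri

variable {A : Type*} [CommRing A] {N : ℕ}

/-- The vertical strip version of Pieri's rule for weighted alternants: multiplying the columns
`j ≥ q` by `1 + c x` adds boxes, at most one to each of the first `N - q` rows. -/
theorem det_pieri (x : Fin N → A) (c : A) (q : ℕ) (u : Fin N → Fin N → A)
    (hu : ∀ i (j j' : Fin N), q ≤ j → q ≤ j' → u i j = u i j')
    {μ : YoungDiagram} (hμ : μ.rowLen N = 0) {V : Finset YoungDiagram}
    (hV : ∀ ν, ν ∈ V ↔ μ ≤ ν ∧ IsVerticalStrip ν μ ∧ ∀ i, N - q ≤ i → ν.rowLen i = μ.rowLen i) :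
    (Matrix.of fun i j => x i ^ altExp N μ j * ((if q ≤ (j : ℕ) then 1 + c * x i else 1) *
        u i j)).det =
      ∑ ν ∈ V, c ^ (skewCells ν μ).card *
        (Matrix.of fun i j => x i ^ altExp N ν j * u i j).det := by
  classical
  -- The set `s` records the columns whose exponent is raised; the weight `0` rules out columns
  -- before `q`.
  let w : Finset (Fin N) → Fin N → A := fun s j =>
    if j ∈ s then (if q ≤ (j : ℕ) then c else 0) else 1
  let e : Finset (Fin N) → Fin N → ℕ := fun s j => altExp N μ j + if j ∈ s then 1 else 0
  let D : (Fin N → ℕ) → A := fun α => (Matrix.of fun i j => x i ^ α j * u i j).det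
  have hexp : (Matrix.of fun i j => x i ^ altExp N μ j *
      ((if q ≤ (j : ℕ) then 1 + c * x i else 1) * u i j)).det =
        ∑ s : Finset (Fin N), (∏ j, w s j) * D (e s) := by
    rw [← Matrix.det_transpose]
    have := (Matrix.detRowAlternating (R := A) (n := Fin N)).toMultilinearMap.map_add_univ
      (fun j i => (if q ≤ (j : ℕ) then c else 0) * (x i ^ (altExp N μ j + 1) * u i j))
      (fun j i => x i ^ altExp N μ j * u i j)
    refine Eq.trans (congrArg Matrix.det ?_) (this.trans (sum_congr rfl fun s _ => ?_))
    · ext j i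
      simp only [Matrix.transpose_apply, Matrix.of_apply, Pi.add_apply]
      split_ifs <;> ring
    · rw [← Matrix.det_mul_row, ← Matrix.det_transpose]
      refine congrArg Matrix.det ?_
      ext j i
      simp only [Matrix.transpose_apply, Matrix.of_apply, w, e, Finset.piecewise]
      split_ifs <;> simp
  let r : Finset (Fin N) → ℕ → ℕ := fun s i =>
    if h : i < N then μ.rowLen i + (if Fin.rev ⟨i, h⟩ ∈ s then 1 else 0) else 0
  have hr : ∀ s i (h : i < N), r s i =
      μ.rowLen i + (if Fin.rev ⟨i, h⟩ ∈ s then 1 else 0) := fun s i h => dif_pos h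
  let good : Finset (Fin N) → Prop := fun s => (∀ j ∈ s, q ≤ (j : ℕ)) ∧
    Monotone fun j : Fin N => μ.rowLen j.rev + if j ∈ s then 1 else 0
  have hgood : ∀ s : Finset (Fin N), (∏ j, w s j) * D (e s) ≠ 0 → good s := by
    intro s hs
    have hq : ∀ j ∈ s, q ≤ (j : ℕ) := by
      intro j hj
      by_contra h
      exact hs (by rw [prod_eq_zero (mem_univ j) (by simp [w, hj, h]), zero_mul])
    refine ⟨hq, ?_⟩
    rcases N with _ | N
    · exact fun a => a.elim0
    refine Fin.monotone_iff_le_succ.2 fun j => ?_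
    by_contra! hlt
    have hanti := μ.rowLen_anti j.succ.rev j.castSucc.rev
      (Fin.rev_le_rev.2 (Fin.castSucc_lt_succ (i := j)).le)
    have hs1 : j.castSucc ∈ s := by
      by_contra h
      simp only [h, if_false] at hlt
      omega
    have hs2 : j.succ ∉ s := by
      intro h
      simp only [h, hs1, if_true] at hlt
      omega
    have hqj := hq _ hs1
    simp only [hs1, hs2, if_true, if_false] at hlt
    refine hs ?_
    -- At a descent the two row lengths agree and only the left column is raised, so the exponents
    -- coincide. Both columns lie at or after `q`, where `u` does not depend on the column, so they
    -- are equal.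
    have : D (e s) = 0 := by
      refine Matrix.det_zero_of_column_eq (Fin.castSucc_lt_succ (i := j)).ne fun k => ?_
      have h1 : e s j.castSucc = e s j.succ := by
        simp only [e, altExp, hs1, hs2, if_true, if_false, Fin.val_castSucc, Fin.val_succ]
        omega
      have h2 : u k j.castSucc = u k j.succ :=
        hu k _ _ hqj (by rw [Fin.val_castSucc] at hqj; rw [Fin.val_succ]; omega)
      simp only [Matrix.of_apply, h1, h2]
    rw [this, mul_zero]
  have hlen : ∀ s, good s → ∀ i, (rowDiagram N (r s)).rowLen i = if i < N then r s i else 0 := by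
    intro s hs
    refine rowLen_rowDiagram fun i j hij hj => ?_
    have := hs.2 (Fin.rev_le_rev.2 (show (⟨i, by omega⟩ : Fin N) ≤ ⟨j, hj⟩ from hij))
    simp only [Fin.rev_rev] at this
    rw [hr s i (by omega), hr s j hj]
    exact this
  have hlen' : ∀ s, good s → ∀ j : Fin N, (rowDiagram N (r s)).rowLen j.rev =
      μ.rowLen j.rev + if j ∈ s then 1 else 0 := by
    intro s hs j
    rw [hlen s hs, if_pos j.rev.2, hr s _ j.rev.2, Fin.eta, Fin.rev_rev]
  have hVN : ∀ ν ∈ V, ν.rowLen N = 0 := fun ν hν => by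
    rw [((hV ν).1 hν).2.2 N (Nat.sub_le _ _), hμ]
  rw [hexp, ← sum_filter_of_ne (p := good) fun s _ => hgood s]
  refine sum_bij' (fun s _ => rowDiagram N (r s))
    (fun ν _ => univ.filter fun j : Fin N => ν.rowLen j.rev ≠ μ.rowLen j.rev) ?_ ?_ ?_ ?_ ?_
  · intro s hs
    have hs := (mem_filter.1 hs).2
    refine (hV _).2 ⟨le_iff_rowLen_le.2 fun i => ?_, isVerticalStrip_iff.2 fun i => ?_,
      fun i hi => ?_⟩
    · rw [hlen s hs]
      split_ifs with h
      · rw [hr s i h]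
        exact Nat.le_add_right _ _
      · exact (rowLen_eq_zero_of_le hμ (by omega)).le
    · rw [hlen s hs]
      split_ifs with h
      · rw [hr s i h]
        split_ifs <;> omega
      · exact Nat.zero_le _
    · rw [hlen s hs]
      split_ifs with h
      · rw [hr s i h, if_neg, add_zero]
        intro hmem
        have := hs.1 _ hmem
        rw [Fin.val_rev] at this
        dsimp only at this
        omega
      · exact (rowLen_eq_zero_of_le hμ (by omega)).symm
  · intro ν hν
    obtain ⟨h1, h2, h3⟩ := (hV ν).1 hν
    refine mem_filter.2 ⟨mem_univ _, fun j hj => ?_, fun a b hab => ?_⟩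
    · by_contra hlt
      refine (mem_filter.1 hj).2 (h3 _ ?_)
      rw [Fin.val_rev]
      omega
    · have hν' : ∀ j : Fin N, (μ.rowLen j.rev + if j ∈ (univ.filter fun j : Fin N =>
          ν.rowLen j.rev ≠ μ.rowLen j.rev) then 1 else 0) = ν.rowLen j.rev := by
        intro j
        have h4 := le_iff_rowLen_le.1 h1 j.rev
        have h5 := isVerticalStrip_iff.1 h2 j.rev
        simp only [mem_filter, mem_univ, true_and]
        split_ifs <;> omega
      dsimp only
      rw [hν', hν']
      exact ν.rowLen_anti _ _ (Fin.rev_le_rev.2 hab)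
  · intro s hs
    have hs := (mem_filter.1 hs).2
    ext j
    rw [mem_filter, hlen' s hs]
    by_cases h : j ∈ s <;> simp [h]
  · intro ν hν
    obtain ⟨h1, h2, h3⟩ := (hV ν).1 hν
    have hν' : ∀ i, i < N → r (univ.filter fun j : Fin N =>
        ν.rowLen j.rev ≠ μ.rowLen j.rev) i = ν.rowLen i := by
      intro i hi
      have h4 := le_iff_rowLen_le.1 h1 i
      have h5 := isVerticalStrip_iff.1 h2 i
      rw [hr _ i hi]
      simp only [mem_filter, mem_univ, true_and, Fin.rev_rev]
      split_ifs <;> omega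
    refine eq_of_rowLen_eq fun i => ?_
    rw [rowLen_rowDiagram]
    · split_ifs with h
      · exact hν' i h
      · exact (rowLen_eq_zero_of_le (hVN ν hν) (by omega)).symm
    · intro i j hij hj
      rw [hν' i (by omega), hν' j hj]
      exact ν.rowLen_anti i j hij
  · intro s hs
    have hs := (mem_filter.1 hs).2
    have he : altExp N (rowDiagram N (r s)) = e s := by
      funext j
      simp only [altExp, hlen' s hs, e]
      omega
    have hw : ∏ j, w s j = c ^ (skewCells (rowDiagram N (r s)) μ).card := by
      rw [card_skewCells (N := N) (by rw [hlen s hs, if_neg (lt_irrefl N)]),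
        ← prod_pow_eq_pow_sum]
      refine prod_congr rfl fun j _ => ?_
      rw [hlen' s hs, Nat.add_sub_cancel_left]
      by_cases h : j ∈ s
      · simp [w, h, hs.1 j h]
      · simp [w, h]
    rw [hw, he]

end Pieri

/-! ### Expansion of the two products, and passage to an arbitrary ring. -/

section Expansion

variable {A : Type*} [CommRing A] {N : ℕ}

theorem subdiagrams_staircase_zero : subdiagrams (staircase 0) = {⊥} := by
  ext ν
  rw [mem_subdiagrams, mem_singleton]
  constructor
  · intro h
    have := le_iff_rowLen_le.1 h 0
    rw [rowLen_staircase] at this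
    exact eq_bot_of_rowLen_zero (by omega)
  · rintro rfl
    exact bot_le

theorem sum_det_pieri (x : Fin N → A) (c : A) {n : ℕ} (hn : n ≤ N) (u : Fin N → Fin N → A)
    (hu : ∀ i (j j' : Fin N), N - n ≤ j → N - n ≤ j' → u i j = u i j') (a : YoungDiagram → A) :
    ∑ μ ∈ subdiagrams (staircase (n - 1)), a μ *
        (Matrix.of fun i j => x i ^ altExp N μ j *
          ((if N - n ≤ (j : ℕ) then 1 + c * x i else 1) * u i j)).det =
      ∑ ν ∈ subdiagrams (staircase n),
        (∑ μ ∈ subdiagrams (ν ⊓ staircase (n - 1)) with IsVerticalStrip ν μ,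
          c ^ (skewCells ν μ).card * a μ) *
        (Matrix.of fun i j => x i ^ altExp N ν j * u i j).det := by
  classical
  have h1 : ∀ μ ∈ subdiagrams (staircase (n - 1)), a μ *
        (Matrix.of fun i j => x i ^ altExp N μ j *
          ((if N - n ≤ (j : ℕ) then 1 + c * x i else 1) * u i j)).det =
      ∑ ν ∈ subdiagrams (staircase n) with μ ≤ ν ∧ IsVerticalStrip ν μ,
        c ^ (skewCells ν μ).card * a μ *
          (Matrix.of fun i j => x i ^ altExp N ν j * u i j).det := by
    intro μ hμ
    have hμ' := fun i => le_iff_rowLen_le.1 (mem_subdiagrams.1 hμ) i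
    simp only [rowLen_staircase] at hμ'
    rw [det_pieri x c (N - n) u hu (by have := hμ' N; omega)
      (V := (subdiagrams (staircase n)).filter fun ν => μ ≤ ν ∧ IsVerticalStrip ν μ), mul_sum]
    · exact sum_congr rfl fun ν _ => by ring
    · intro ν
      -- For `μ ⊆ δ_{n-1}`, adding at most one box to each of the first `n` rows and none below is
      -- the same as adding a vertical strip inside `δ_n`.
      rw [mem_filter, mem_subdiagrams, Nat.sub_sub_self hn, isVerticalStrip_iff]
      constructor
      · rintro ⟨h1, h2, h3⟩
        refine ⟨h2, h3, fun i hi => ?_⟩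
        have h4 := le_iff_rowLen_le.1 h1 i
        have h5 := hμ' i
        rw [rowLen_staircase] at h4
        omega
      · rintro ⟨h1, h2, h3⟩
        refine ⟨le_iff_rowLen_le.2 fun i => ?_, h1, h2⟩
        have h4 := h2 i
        have h5 := hμ' i
        have h6 := h3 i
        rw [rowLen_staircase]
        omega
  rw [sum_congr rfl h1]
  simp only [sum_mul]
  refine sum_comm' fun μ ν => ?_
  simp only [mem_filter, mem_subdiagrams, le_inf_iff]
  tauto

theorem reverseFlaggedCount_succ_eq_sum {n : ℕ} {ν : YoungDiagram} (hν : ν ≤ staircase n) :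
    reverseFlaggedCount (n + 1) ν =
      ∑ μ ∈ subdiagrams (ν ⊓ staircase (n - 1)) with IsVerticalStrip ν μ,
        reverseFlaggedCount n μ := by
  have h0 := le_iff_rowLen_le.1 hν n
  rw [rowLen_staircase] at h0
  rw [reverseFlaggedCount_succ (by omega)]
  refine (sum_subset ?_ ?_).symm
  · intro μ
    simp only [mem_filter, mem_subdiagrams, le_inf_iff]
    tauto
  · intro μ h1 h2
    refine reverseFlaggedCount_eq_zero fun h => h2 ?_
    simp only [mem_filter, mem_subdiagrams, le_inf_iff] at h1 ⊢
    tauto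

/-- The parameter `n` counts rounds of stripping: at `n = 0` the cap `N - n` is inactive and the
matrix is the Vandermonde matrix itself, while at `n = N` no factor `1 + x i` is left. -/
theorem det_vandermonde_add_sq_eq_sum (x : Fin N → A) {n : ℕ} (hn : n ≤ N) :
    (Matrix.vandermonde fun i => x i + x i ^ 2).det =
      ∑ μ ∈ subdiagrams (staircase (n - 1)), (reverseFlaggedCount n μ : A) *
        (Matrix.of fun i j => x i ^ altExp N μ j * (1 + x i) ^ min (j : ℕ) (N - n)).det := by
  induction n with
  | zero =>
    rw [Nat.zero_sub, subdiagrams_staircase_zero, sum_singleton, reverseFlaggedCount_bot,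
      Nat.cast_one, one_mul]
    refine congrArg Matrix.det ?_
    ext i j
    rw [Matrix.vandermonde_apply, Matrix.of_apply, altExp, rowLen_bot, zero_add, Nat.sub_zero,
      min_eq_left j.2.le, ← mul_pow]
    ring
  | succ n ih =>
    have hu : ∀ i (j j' : Fin N), N - n ≤ j → N - n ≤ j' →
        (1 + x i) ^ min (j : ℕ) (N - (n + 1)) = (1 + x i) ^ min (j' : ℕ) (N - (n + 1)) := by
      intro i j j' hj hj'
      congr 1
      omega
    -- Lowering the cap by one affects only the columns `j ≥ N - n`, which afterwards all carry the
    -- same power, as `det_pieri` requires.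
    have hpow : ∀ i (j : Fin N), (1 + x i) ^ min (j : ℕ) (N - n) =
        (if N - n ≤ (j : ℕ) then 1 + 1 * x i else 1) *
          (1 + x i) ^ min (j : ℕ) (N - (n + 1)) := by
      intro i j
      split_ifs with h
      · rw [one_mul, ← pow_succ']
        congr 1
        omega
      · rw [one_mul]
        congr 1
        omega
    rw [ih (by omega)]
    simp only [hpow]
    rw [sum_det_pieri x 1 (by omega) (fun i j => (1 + x i) ^ min (j : ℕ) (N - (n + 1))) hu,
      Nat.add_sub_cancel]
    refine sum_congr rfl fun ν hν => ?_
    rw [reverseFlaggedCount_succ_eq_sum (mem_subdiagrams.1 hν)]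
    simp

theorem vandermonde_mul_prod (x : Fin N → A) :
    (Matrix.vandermonde x).det * ∏ i, ∏ j ∈ Ioi i, (1 + x i + x j) =
      ∑ μ ∈ subdiagrams (staircase (N - 1)), (reverseFlaggedCount N μ : A) * alternant x μ := by
  have h := det_vandermonde_add_sq_eq_sum x le_rfl
  simp only [Nat.sub_self, Nat.min_zero, pow_zero, mul_one] at h
  rw [Matrix.det_vandermonde] at h ⊢
  refine Eq.trans ?_ h
  simp only [← prod_mul_distrib]
  exact prod_congr rfl fun i _ => prod_congr rfl fun j _ => by ring

/-- The diagonal factors `1 + 2 * x i` multiply row `i`, hence every column at once: this is the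
Pieri step with `c = 2` and threshold `N - N = 0`. -/
theorem vandermonde_mul_prod_Ici (x : Fin N → A) :
    (Matrix.vandermonde x).det * ∏ i, ∏ j ∈ Ici i, (1 + x i + x j) =
      ∑ ν ∈ subdiagrams (staircase N),
        (∑ μ ∈ subdiagrams (ν ⊓ staircase (N - 1)) with IsVerticalStrip ν μ,
          2 ^ (skewCells ν μ).card * (reverseFlaggedCount N μ : A)) * alternant x ν := by
  have h := sum_det_pieri x 2 (le_refl N) (fun _ _ => 1) (fun _ _ _ _ _ => rfl)
    (fun μ => (reverseFlaggedCount N μ : A))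
  simp only [Nat.sub_self, Nat.zero_le, if_true, mul_one] at h
  refine Eq.trans ?_ h
  have hcol : ∀ μ, (Matrix.of fun i j => x i ^ altExp N μ j * (1 + 2 * x i)).det =
      (∏ i, (1 + 2 * x i)) * alternant x μ := by
    intro μ
    rw [alternant, ← Matrix.det_mul_column]
    simp only [Matrix.of_apply, mul_comm]
  simp only [hcol, mul_left_comm _ (∏ i, (1 + 2 * x i))]
  rw [← mul_sum, ← vandermonde_mul_prod, mul_left_comm, ← prod_mul_distrib]
  congr 1
  refine prod_congr rfl fun i _ => ?_
  rw [← Ioi_insert, prod_insert (by simp)]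
  ring

theorem alternant_eq_of_le_staircase (x : Fin N → A) {m : ℕ} (hm : m ≤ N) {μ : YoungDiagram}
    (hμ : μ ∈ subdiagrams (staircase m)) :
    alternant x μ = (Matrix.vandermonde x).det * schurEval x μ := by
  refine alternant_eq_vandermonde_mul_schurEval x ?_
  have := le_iff_rowLen_le.1 (mem_subdiagrams.1 hμ) N
  rw [rowLen_staircase] at this
  omega

theorem map_schurEval {B : Type*} [CommRing B] (φ : A →+* B) (x : Fin N → A)
    (μ : YoungDiagram) : φ (schurEval x μ) = schurEval (fun i => φ (x i)) μ := by
  simp [schurEval]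

theorem eval₂_schurEval_X (x : Fin N → A) (μ : YoungDiagram) :
    MvPolynomial.eval₂ (Int.castRingHom A) x (schurEval MvPolynomial.X μ) = schurEval x μ := by
  simpa using map_schurEval (MvPolynomial.eval₂Hom (Int.castRingHom A) x) MvPolynomial.X μ

theorem det_vandermonde_X_ne_zero (N : ℕ) :
    (Matrix.vandermonde (MvPolynomial.X : Fin N → MvPolynomial (Fin N) ℤ)).det ≠ 0 :=
  Matrix.det_vandermonde_ne_zero_iff.2 (MvPolynomial.X_injective)

theorem prod_Ioi_eq_sum_schurEval (x : Fin N → A) :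
    ∏ i, ∏ j ∈ Ioi i, (1 + x i + x j) =
      ∑ μ ∈ subdiagrams (staircase (N - 1)),
        (reverseFlaggedCount N μ : A) * schurEval x μ := by
  have h : ∏ i : Fin N, ∏ j ∈ Ioi i,
      (1 + MvPolynomial.X i + MvPolynomial.X j : MvPolynomial (Fin N) ℤ) =
      ∑ μ ∈ subdiagrams (staircase (N - 1)), (reverseFlaggedCount N μ : MvPolynomial (Fin N) ℤ) *
        schurEval MvPolynomial.X μ := by
    refine mul_left_cancel₀ (det_vandermonde_X_ne_zero N) ?_
    -- Over `ℤ` the polynomial ring is a domain, so the Vandermonde determinant cancels; over a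
    -- general coefficient ring this argument is not available.
    rw [vandermonde_mul_prod, mul_sum]
    refine sum_congr rfl fun μ hμ => ?_
    rw [alternant_eq_of_le_staircase _ (Nat.sub_le N 1) hμ, mul_left_comm]
  simpa [eval₂_schurEval_X] using congrArg (MvPolynomial.eval₂Hom (Int.castRingHom A) x) h

theorem prod_Ici_eq_sum_schurEval (x : Fin N → A) :
    ∏ i, ∏ j ∈ Ici i, (1 + x i + x j) =
      ∑ ν ∈ subdiagrams (staircase N),
        (∑ μ ∈ subdiagrams (ν ⊓ staircase (N - 1)) with IsVerticalStrip ν μ,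
          2 ^ (skewCells ν μ).card * (reverseFlaggedCount N μ : A)) * schurEval x ν := by
  have h : ∏ i : Fin N, ∏ j ∈ Ici i,
      (1 + MvPolynomial.X i + MvPolynomial.X j : MvPolynomial (Fin N) ℤ) =
      ∑ ν ∈ subdiagrams (staircase N),
        (∑ μ ∈ subdiagrams (ν ⊓ staircase (N - 1)) with IsVerticalStrip ν μ,
          2 ^ (skewCells ν μ).card * (reverseFlaggedCount N μ : MvPolynomial (Fin N) ℤ)) *
        schurEval MvPolynomial.X ν := by
    refine mul_left_cancel₀ (det_vandermonde_X_ne_zero N) ?_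
    rw [vandermonde_mul_prod_Ici, mul_sum]
    refine sum_congr rfl fun ν hν => ?_
    rw [alternant_eq_of_le_staircase _ le_rfl hν, mul_left_comm]
  simpa [eval₂_schurEval_X] using congrArg (MvPolynomial.eval₂Hom (Int.castRingHom A) x) h

end Expansion

end LascouxSchur

theorem theorem4p2 {R : Type*} [CommRing R] (n : ℕ) (hn : 1 ≤ n) :
    (∏ i : Fin n, ∏ j ∈ Finset.Ioi i,
        (1 + MvPolynomial.X i + MvPolynomial.X j : MvPolynomial (Fin n) R)) =
      ∑ μ ∈ LascouxSchur.subdiagrams (LascouxSchur.staircase (n - 1)),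
        (LascouxSchur.reverseFlaggedCount n μ : MvPolynomial (Fin n) R) *
          LascouxSchur.schurPoly R n μ ∧
    (∏ i : Fin n, ∏ j ∈ Finset.Ici i,
        (1 + MvPolynomial.X i + MvPolynomial.X j : MvPolynomial (Fin n) R)) =
      ∑ ν ∈ LascouxSchur.subdiagrams (LascouxSchur.staircase n),
        ∑ μ ∈ LascouxSchur.subdiagrams (ν ⊓ LascouxSchur.staircase (n - 1)) with
            LascouxSchur.IsVerticalStrip ν μ,
          (2 ^ (LascouxSchur.skewCells ν μ).card *
              LascouxSchur.reverseFlaggedCount n μ : MvPolynomial (Fin n) R) *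
            LascouxSchur.schurPoly R n ν := by
  -- `schurPoly` is by definition `schurEval` at the indeterminates.
  refine ⟨LascouxSchur.prod_Ioi_eq_sum_schurEval MvPolynomial.X,
    (LascouxSchur.prod_Ici_eq_sum_schurEval MvPolynomial.X).trans ?_⟩
  refine Finset.sum_congr rfl fun ν _ => ?_
  rw [Finset.sum_mul]
  rfl
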